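/- An additively separable hedonic game (ASHG) consists of a finite set $N$ of players and values $v_i(j)$ for $i,j\in N$. Player $i$ has utility $\sum_{j\in S\setminus\{i\}} v_i(j)$ in a coalition $S\ni i$ and weakly (strictly) prefers $S$ to $T$ if her utility in $S$ is at least (greater than) that in $T$. Preferences are strict if $v_i(j)\neq 0$ for all $i\neq j$. For a partition $\pi$ of $N$ into coalitions, $\pi(i)$ is the coalition containing $i$. A partition $\pi$ is Pareto optimal if there is no partition $\pi'$ such that every player $i$ weakly prefers $\pi'(i)$ to $\pi(i)$ and some player $j$ strictly prefers $\pi'(j)$ to $\pi(j)$. Serial dictatorship starts with all players remaining; as long as players remain, an arbitrary remaining player $d$ (the dictator) forms a coalition with all remaining players $j$ with $v_d(j)>0$, and the members of this coalition are removed. **Theorem.** (1) In every ASHG with real values and strict preferences, every partition that results from serial dictatorship, for any choice of the dictators, is Pareto optimal. (2) For ASHGs with strict preferences, a Pareto optimal partition can be computed in polynomial time: there is a Turing machine that, given an ASHG with player set $\{0,\dots,n-1\}$, rational values and strict preferences (written as the matrix of values $v_i(j)$, with numerators and denominators in binary), outputs in time polynomial in the length of the input a Pareto optimal partition (written as the list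 of its coalitions in the order of their least members, each coalition as its characteristic bit vector), and this partition is an outcome of serial dictatorship. -/

import Mathlib

/-- An additively separable hedonic game with player set `N`: `value i j` is the value that
player `i` assigns to player `j`. The diagonal values `value i i` play no role. -/
structure ASHG (N R : Type*) where
  value : N → N → R

namespace ASHG

variable {N R : Type*} [DecidableEq N] [AddCommMonoid R] [LinearOrder R]

/-- The utility of player `i` in a coalition `S` containing `i`. -/
def utility (G : ASHG N R) (i : N) (S : Finset N) : R :=
  ∑ j ∈ S \ {i}, G.value i j

/-- Player `i` weakly prefers the coalition `S` to the coalition `T`. -/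
def WeakPref (G : ASHG N R) (i : N) (S T : Finset N) : Prop :=
  G.utility i S ≥ G.utility i T

/-- Player `i` strictly prefers the coalition `S` to the coalition `T`. -/
def StrictPref (G : ASHG N R) (i : N) (S T : Finset N) : Prop :=
  G.WeakPref i S T ∧ ¬ G.WeakPref i T S

/-- The preference profile is strict: no player assigns value zero to another player. -/
def IsStrict (G : ASHG N R) : Prop :=
  ∀ i j : N, i ≠ j → G.value i j ≠ 0

/-- `π'` Pareto dominates `π`; here `π.part i` is the coalition of `π` that contains `i`. -/
def ParetoDominates [Fintype N] (G : ASHG N R)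
    (π' π : Finpartition (Finset.univ : Finset N)) : Prop :=
  (∀ i, G.WeakPref i (π'.part i) (π.part i)) ∧ ∃ j, G.StrictPref j (π'.part j) (π.part j)

def IsParetoOptimal [Fintype N] (G : ASHG N R)
    (π : Finpartition (Finset.univ : Finset N)) : Prop :=
  ¬ ∃ π' : Finpartition (Finset.univ : Finset N), G.ParetoDominates π' π

/-- The coalition formed by the dictator `d` when the players in `A` remain: `d` together with
all remaining players whom `d` strictly likes. -/
def dictatorCoalition (G : ASHG N R) (A : Finset N) (d : N) : Finset N :=
  insert d (A.filter fun j => 0 < G.value d j)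

/-- `SerialDictatorship G A L`: starting with the set `A` of remaining players, some run of serial
dictatorship (with arbitrary choices of the dictators) forms the coalitions in the list `L`, in
this order. -/
inductive SerialDictatorship (G : ASHG N R) : Finset N → List (Finset N) → Prop
  | done : SerialDictatorship G ∅ []
  | step (A : Finset N) (d : N) (L : List (Finset N)) (hd : d ∈ A)
      (h : SerialDictatorship G (A \ G.dictatorCoalition A d) L) :
      SerialDictatorship G A (G.dictatorCoalition A d :: L)

/-- The partition `π` is the outcome of some run of serial dictatorship on all players. -/
def IsSerialDictatorshipOutcome [Fintype N] (G : ASHG N R)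
    (π : Finpartition (Finset.univ : Finset N)) : Prop :=
  ∃ L : List (Finset N), G.SerialDictatorship Finset.univ L ∧ L.toFinset = π.parts

end ASHG

/-- Problem instances: games with players `0, …, n - 1`, rational values, and strict
preferences. -/
structure StrictGame where
  n : ℕ
  game : ASHG (Fin n) ℚ
  strict : game.IsStrict

/-- The alphabet in which games and partitions are written. -/
inductive GameSymbol
  | bit (b : Bool)
  | minus
  | slash
  | comma
  | semicolon
  deriving DecidableEq, Fintype

/-- Natural numbers in binary (least significant bit first, `0` is the empty word). -/
def encodeBinary (k : ℕ) : List GameSymbol :=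
  (Computability.encodeNat k).map GameSymbol.bit

/-- A rational number: optional minus sign, numerator and denominator in lowest terms. -/
def encodeRat (q : ℚ) : List GameSymbol :=
  (if q < 0 then [GameSymbol.minus] else []) ++
    (encodeBinary q.num.natAbs ++ (GameSymbol.slash :: encodeBinary q.den))

/-- The value matrix, row by row: each entry is followed by a comma, each row by a semicolon. -/
def encodeGame (I : StrictGame) : List GameSymbol :=
  (List.finRange I.n).flatMap fun i =>
    ((List.finRange I.n).flatMap fun j => encodeRat (I.game.value i j) ++ [GameSymbol.comma]) ++
      [GameSymbol.semicolon]

/-- The list of the coalitions of a partition of `{0, …, n - 1}`, in the order of their least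
members; each coalition is written as its characteristic bit vector followed by a semicolon. -/
def encodePartition (P : Σ n : ℕ, Finpartition (Finset.univ : Finset (Fin n))) : List GameSymbol :=
  ((List.finRange P.1).filter fun i => ∀ j ∈ P.2.part i, i ≤ j).flatMap fun i =>
    (List.finRange P.1).map (fun j => GameSymbol.bit (decide (j ∈ P.2.part i))) ++ [GameSymbol.semicolon]

/-! The encodings are faithful: a game and a partition can be recovered from their codes. -/

theorem terminator_cancel {α : Type*} {t : α} : ∀ {a b x y : List α}, t ∉ a → t ∉ b →
    a ++ t :: x = b ++ t :: y → a = b ∧ x = y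
  | [], [], x, y, _, _, h => by simpa using h
  | [], c :: b, x, y, _, hb, h => by simp_all
  | c :: a, [], x, y, ha, _, h => by simp_all
  | c :: a, d :: b, x, y, ha, hb, h => by
      simp only [List.cons_append, List.cons.injEq] at h
      have := terminator_cancel (fun h' => ha (by simp [h'])) (fun h' => hb (by simp [h'])) h.2
      exact ⟨by rw [h.1, this.1], this.2⟩

theorem flatMap_terminator_cancel {α β γ : Type*} {t : α} {g : β → List α} {k : γ → List α}
    (hg : ∀ b, t ∉ g b) (hk : ∀ c, t ∉ k c) : ∀ {L : List β} {M : List γ},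
    (L.flatMap fun b => g b ++ [t]) = (M.flatMap fun c => k c ++ [t]) → L.map g = M.map k
  | [], [], _ => rfl
  | [], c :: M, h => by simp at h
  | b :: L, [], h => by simp at h
  | b :: L, c :: M, h => by
      simp only [List.flatMap_cons, List.append_assoc, List.singleton_append] at h
      have := terminator_cancel (hg b) (hk c) h
      simp [this.1, flatMap_terminator_cancel hg hk this.2]

theorem encodeBinary_injective : Function.Injective encodeBinary := by
  intro a b h
  have h' := (List.map_injective_iff.mpr fun x y h => by simpa using h) h
  exact Computability.encodingNatBool.encode_injective h'

theorem notMem_encodeBinary {k : ℕ} {s : GameSymbol} (hs : ∀ b, s ≠ .bit b) :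
    s ∉ encodeBinary k := by
  simp only [encodeBinary, List.mem_map, not_exists, not_and]
  exact fun b _ h => hs b h.symm

theorem notMem_encodeRat {q : ℚ} {s : GameSymbol} (hs : ∀ b, s ≠ .bit b) (h1 : s ≠ .minus)
    (h2 : s ≠ .slash) : s ∉ encodeRat q := by
  have := fun k => notMem_encodeBinary (k := k) hs
  unfold encodeRat
  split <;> simp [*]

theorem encodeRat_injective : Function.Injective encodeRat := by
  intro p q h
  have key : ∀ r : ℚ, GameSymbol.minus ∈ encodeRat r ↔ r < 0 := by
    intro r
    have := fun k => notMem_encodeBinary (k := k) (s := .minus) (by simp)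
    unfold encodeRat
    split <;> simp [*]
  have hs : p < 0 ↔ q < 0 := by rw [← key, ← key, h]
  have h' : encodeBinary p.num.natAbs ++ (GameSymbol.slash :: encodeBinary p.den) =
      encodeBinary q.num.natAbs ++ (GameSymbol.slash :: encodeBinary q.den) := by
    unfold encodeRat at h
    simp only [hs] at h
    exact List.append_cancel_left h
  obtain ⟨hn, hd⟩ := terminator_cancel (notMem_encodeBinary (by simp))
    (notMem_encodeBinary (by simp)) h'
  have hn := encodeBinary_injective hn
  have hd := encodeBinary_injective hd
  refine Rat.ext ?_ hd
  rw [← Rat.num_neg, ← Rat.num_neg] at hs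
  omega

theorem encodeGame_injective : Function.Injective encodeGame := by
  have hr : ∀ (r : ℚ), GameSymbol.comma ∉ encodeRat r := fun r =>
    notMem_encodeRat (by simp) (by simp) (by simp)
  have hrow : ∀ (I : StrictGame) (i : Fin I.n), GameSymbol.semicolon ∉
      (List.finRange I.n).flatMap fun j => encodeRat (I.game.value i j) ++ [GameSymbol.comma] := by
    intro I i
    have : ∀ (r : ℚ), GameSymbol.semicolon ∉ encodeRat r := fun r =>
      notMem_encodeRat (by simp) (by simp) (by simp)
    simp [this]
  rintro ⟨n, ⟨v⟩, hv⟩ ⟨m, ⟨w⟩, hw⟩ h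
  have h1 := flatMap_terminator_cancel (hrow ⟨n, ⟨v⟩, hv⟩) (hrow ⟨m, ⟨w⟩, hw⟩) h
  have hnm : n = m := by simpa using congrArg List.length h1
  subst hnm
  have : v = w := by
    funext i j
    have h2 := List.map_inj_left.mp h1 i (List.mem_finRange i)
    have h3 := flatMap_terminator_cancel (fun j => hr (v i j)) (fun j => hr (w i j)) h2
    exact encodeRat_injective (List.map_inj_left.mp h3 j (List.mem_finRange j))
  subst this
  rfl

theorem encodePartition_injective : Function.Injective encodePartition := by
  rintro ⟨n, π⟩ ⟨m, ρ⟩ h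
  have hrow : ∀ (n : ℕ) (π : Finpartition (Finset.univ : Finset (Fin n))) (i : Fin n),
      GameSymbol.semicolon ∉
        (List.finRange n).map (fun j => GameSymbol.bit (decide (j ∈ π.part i))) := by
    simp
  have h1 := flatMap_terminator_cancel (hrow n π) (hrow m ρ) h
  have least : ∀ (n : ℕ) (π : Finpartition (Finset.univ : Finset (Fin n))) (S : Finset (Fin n)),
      S ∈ π.parts ↔ ∃ i, (∀ j ∈ π.part i, i ≤ j) ∧ π.part i = S := by
    intro n π S
    constructor
    · intro hS
      have hne := π.nonempty_of_mem_parts hS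
      have e := π.part_eq_of_mem hS (S.min'_mem hne)
      exact ⟨S.min' hne, fun j hj => S.min'_le j (e ▸ hj), e⟩
    · rintro ⟨i, -, rfl⟩
      exact π.part_mem.mpr (Finset.mem_univ i)
  have hnm : n = m := by
    rcases Nat.eq_zero_or_pos n with rfl | hn
    · rcases Nat.eq_zero_or_pos m with rfl | hm
      · rfl
      · obtain ⟨i, hi, -⟩ := (least m ρ _).mp (ρ.part_mem.mpr (Finset.mem_univ ⟨0, hm⟩))
        have : (List.map (fun j => GameSymbol.bit (decide (j ∈ ρ.part i))) (List.finRange m)) ∈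
            ([] : List (List GameSymbol)) := by
          have h2 := h1.symm
          simp only [List.finRange_zero, List.filter_nil, List.map_nil] at h2
          rw [← h2]
          exact List.mem_map.mpr ⟨i, by simpa using hi, rfl⟩
        simp at this
    · obtain ⟨i, hi, -⟩ := (least n π _).mp (π.part_mem.mpr (Finset.mem_univ ⟨0, hn⟩))
      have : (List.map (fun j => GameSymbol.bit (decide (j ∈ π.part i))) (List.finRange n)) ∈
          List.map (fun i => List.map (fun j => GameSymbol.bit (decide (j ∈ ρ.part i)))
            (List.finRange m)) ((List.finRange m).filter fun i => ∀ j ∈ ρ.part i, i ≤ j) := by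
        rw [← h1]
        exact List.mem_map.mpr ⟨i, by simpa using hi, rfl⟩
      obtain ⟨k, -, hk⟩ := List.mem_map.mp this
      simpa using (congrArg List.length hk).symm
  subst hnm
  have sub : ∀ π ρ : Finpartition (Finset.univ : Finset (Fin n)),
      (((List.finRange n).filter fun i => ∀ j ∈ π.part i, i ≤ j).map fun i =>
        (List.finRange n).map (fun j => GameSymbol.bit (decide (j ∈ π.part i)))) =
      (((List.finRange n).filter fun i => ∀ j ∈ ρ.part i, i ≤ j).map fun i =>
        (List.finRange n).map (fun j => GameSymbol.bit (decide (j ∈ ρ.part i)))) →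
      π.parts ⊆ ρ.parts := by
    intro π ρ h S hS
    obtain ⟨i, hi, rfl⟩ := (least n π S).mp hS
    have hm : (List.finRange n).map (fun j => GameSymbol.bit (decide (j ∈ π.part i))) ∈
        (((List.finRange n).filter fun i => ∀ j ∈ π.part i, i ≤ j).map fun i =>
          (List.finRange n).map (fun j => GameSymbol.bit (decide (j ∈ π.part i)))) :=
      List.mem_map.mpr ⟨i, by simpa using hi, rfl⟩
    rw [h] at hm
    obtain ⟨k, -, hk⟩ := List.mem_map.mp hm
    have : ρ.part k = π.part i := by
      ext j
      simpa using List.map_inj_left.mp hk j (List.mem_finRange j)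
    exact this ▸ ρ.part_mem.mpr (Finset.mem_univ k)
  have : π = ρ := Finpartition.ext ((sub π ρ h1).antisymm (sub ρ π h1.symm))
  rw [this]

/-! Optimality. By strictness, a dictator's coalition is her unique favourite among the coalitions
of remaining players: losing a member or gaining another remaining player lowers her utility
(`eq_dictatorCoalition_of_utility_le`). If everybody weakly prefers a partition `π'` to the outcome,
the first dictator's coalition must therefore be a block of `π'`. The remaining players are then a
union of blocks of `π'`, and induction along the run makes the two partitions agree
(`SerialDictatorship.part_eq`), so nobody gains strictly.

Computation. Let the least remaining player always be the dictator. Coalitions then arise in the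
order of their least members, as the output format demands (`encodePartition_serialPartition`), and
one pass through the matrix suffices. For each column the machine only stores whether the player is
past, taken or free. The first column that is not past is the diagonal, and its status tells whether
the row belongs to a dictator. By strictness only the sign of an off-diagonal value matters, and the
first symbol of its code shows it, so no arithmetic is needed.

The bits before the diagonal are written before it is known whether the row counts. Hence every row
goes to a log; popping the log meets the terminator of a row before its bits, which decides whether
to copy or drop them, and also restores the order. The running time is linear in the input length,
because a game with `n` players has a code of length at least `n * (n + 1)`. -/

namespace ASHG

/-! ### Pareto optimality of serial dictatorship -/

section Pareto

variable {N R : Type*} [DecidableEq N] [AddCommGroup R] [LinearOrder R] [IsOrderedAddMonoid R]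

/-- The coalition of a dictator is her unique favourite among the coalitions of remaining
players. -/
theorem eq_dictatorCoalition_of_utility_le {G : ASHG N R} (hG : G.IsStrict) {A T : Finset N}
    {d : N} (hT : T ⊆ A) (hdT : d ∈ T)
    (h : G.utility d (G.dictatorCoalition A d) ≤ G.utility d T) :
    T = G.dictatorCoalition A d := by
  by_contra hne
  set C := G.dictatorCoalition A d with hC
  have hdC : d ∈ C := Finset.mem_insert_self _ _
  have pos : ∀ j ∈ C \ T, 0 < G.value d j := by
    intro j hj
    obtain ⟨hjC, hjT⟩ := Finset.mem_sdiff.mp hj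
    rcases Finset.mem_insert.mp hjC with rfl | hjC
    · exact absurd hdT hjT
    · exact (Finset.mem_filter.mp hjC).2
  have neg : ∀ j ∈ T \ C, G.value d j < 0 := by
    intro j hj
    obtain ⟨hjT, hjC⟩ := Finset.mem_sdiff.mp hj
    have hjd : d ≠ j := fun e => hjC (e ▸ hdC)
    refine lt_of_le_of_ne (not_lt.mp fun hp => hjC ?_) (hG d j hjd)
    exact Finset.mem_insert_of_mem (Finset.mem_filter.mpr ⟨hT hjT, hp⟩)
  -- As `d ∈ U`, she is not in `S \ U`. For the pairs `C, T` and `T, C` the second sums coincide and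
  -- cancel, leaving positive values on `C \ T` and negative ones on `T \ C`.
  have split : ∀ S U : Finset N, d ∈ U → G.utility d S =
      ∑ j ∈ S \ U, G.value d j + ∑ j ∈ (S ∩ U) \ {d}, G.value d j := by
    intro S U hU
    rw [utility, ← Finset.sum_union]
    · congr 1
      ext j
      simp only [Finset.mem_sdiff, Finset.mem_union, Finset.mem_inter, Finset.mem_singleton]
      grind
    · rw [Finset.disjoint_left]
      simp only [Finset.mem_sdiff, Finset.mem_inter]
      tauto
  rw [split C T hdT, split T C hdC, Finset.inter_comm, add_le_add_iff_right] at h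
  have h1 : 0 ≤ ∑ j ∈ C \ T, G.value d j := Finset.sum_nonneg fun j hj => (pos j hj).le
  have h2 : ∑ j ∈ T \ C, G.value d j ≤ 0 := Finset.sum_nonpos fun j hj => (neg j hj).le
  rcases (C \ T).eq_empty_or_nonempty with hCT | hCT
  · rcases (T \ C).eq_empty_or_nonempty with hTC | hTC
    · exact hne ((Finset.sdiff_eq_empty_iff_subset.mp hTC).antisymm
        (Finset.sdiff_eq_empty_iff_subset.mp hCT))
    · exact absurd (h1.trans h) (not_le.mpr (Finset.sum_neg neg hTC))
  · exact absurd (h.trans h2) (not_le.mpr (Finset.sum_pos pos hCT))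

/-- Induction along the run. Only the preferences of the dictators are used; the other members of a
coalition are forced to follow. -/
theorem SerialDictatorship.part_eq [Fintype N] {G : ASHG N R} (hG : G.IsStrict)
    (π : Finpartition (Finset.univ : Finset N)) {A : Finset N} {L : List (Finset N)}
    (hL : G.SerialDictatorship A L) (hA : ∀ i ∈ A, π.part i ⊆ A)
    (hπ : ∀ S ∈ L, ∀ i ∈ S, G.WeakPref i (π.part i) S) :
    ∀ S ∈ L, ∀ i ∈ S, π.part i = S := by
  induction hL with
  | done => simp
  | step A d L hd _ ih =>
    have hdC : d ∈ G.dictatorCoalition A d := Finset.mem_insert_self _ _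
    have hd' := eq_dictatorCoalition_of_utility_le hG (hA d hd) (π.mem_part (Finset.mem_univ d))
      (hπ _ (by simp) d hdC)
    have hC : ∀ i ∈ G.dictatorCoalition A d, π.part i = G.dictatorCoalition A d := by
      intro i hi
      rw [← hd'] at hi ⊢
      exact π.part_eq_of_mem (π.part_mem.mpr (Finset.mem_univ d)) hi
    intro S hS i hi
    rcases List.mem_cons.mp hS with rfl | hS
    · exact hC i hi
    -- The dictator's coalition is a block of `π`, so a block meeting its complement in `A` cannot
    -- meet it.
    refine ih ?_ (fun S hS => hπ S (List.mem_cons_of_mem _ hS)) S hS i hi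
    intro i hi j hj
    obtain ⟨hiA, hiC⟩ := Finset.mem_sdiff.mp hi
    refine Finset.mem_sdiff.mpr ⟨hA i hiA hj, fun hjC => hiC ?_⟩
    rw [← hC j hjC, π.part_eq_of_mem (π.part_mem.mpr (Finset.mem_univ i)) hj]
    exact π.mem_part (Finset.mem_univ i)

theorem IsSerialDictatorshipOutcome.isParetoOptimal [Fintype N] {G : ASHG N R} (hG : G.IsStrict)
    {π : Finpartition (Finset.univ : Finset N)} (hπ : G.IsSerialDictatorshipOutcome π) :
    G.IsParetoOptimal π := by
  obtain ⟨L, hL, hLπ⟩ := hπ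
  rintro ⟨π', hle, j, -, hlt⟩
  have mem : ∀ S, S ∈ L ↔ S ∈ π.parts := fun S => by rw [← hLπ, List.mem_toFinset]
  have key := hL.part_eq hG π' (fun i _ => Finset.subset_univ _) fun S hS i hi => by
    have := hle i
    rwa [π.part_eq_of_mem ((mem S).mp hS) hi] at this
  have hj := key _ ((mem _).mpr (π.part_mem.mpr (Finset.mem_univ j))) j
    (π.mem_part (Finset.mem_univ j))
  exact hlt (by rw [hj]; exact le_refl _)

end Pareto

/-! ### Serial dictatorship in a prescribed order of the players -/

section Greedy

variable {N R : Type*} [DecidableEq N] [AddCommMonoid R] [LinearOrder R]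

/-- Serial dictatorship in which the players are asked in the order of the given list; the result
lists the dictators with their coalitions. -/
def serialRun (G : ASHG N R) : List N → Finset N → List (N × Finset N)
  | [], _ => []
  | d :: L, A =>
    if d ∈ A then (d, G.dictatorCoalition A d) :: serialRun G L (A \ G.dictatorCoalition A d)
    else serialRun G L A

theorem subset_tail_of_sdiff {L : List N} {d : N} {A C : Finset N} (hA : A ⊆ (d :: L).toFinset)
    (hd : d ∈ C) : A \ C ⊆ L.toFinset := by
  intro j hj
  obtain ⟨h1, h2⟩ := Finset.mem_sdiff.mp hj
  have := hA h1
  simp only [List.mem_toFinset, List.mem_cons] at this ⊢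
  exact this.resolve_left fun e => h2 (e ▸ hd)

theorem subset_tail_of_notMem {L : List N} {d : N} {A : Finset N} (hA : A ⊆ (d :: L).toFinset)
    (hd : d ∉ A) : A ⊆ L.toFinset := by
  intro j hj
  have := hA hj
  simp only [List.mem_toFinset, List.mem_cons] at this ⊢
  exact this.resolve_left fun e => hd (e ▸ hj)

theorem serialDictatorship_serialRun (G : ASHG N R) (L : List N) (A : Finset N)
    (hA : A ⊆ L.toFinset) : G.SerialDictatorship A ((G.serialRun L A).map Prod.snd) := by
  induction L generalizing A with
  | nil =>
    obtain rfl : A = ∅ := by simpa using hA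
    exact .done
  | cons d L ih =>
    unfold serialRun
    split_ifs with hd
    · exact .step A d _ hd (ih _ (subset_tail_of_sdiff hA (Finset.mem_insert_self _ _)))
    · exact ih _ (subset_tail_of_notMem hA hd)

/-- Identifies the dictators, a sublist of all players, with the filtered list of least members in
`encodePartition`, including the order. -/
theorem filter_mem_eq_of_sublist {L M : List N} (h : L.Sublist M) (hM : M.Nodup) :
    (M.filter fun i => i ∈ L) = L := by
  induction h with
  | slnil => rfl
  | cons a h ih =>
    obtain ⟨ha, hM⟩ := List.nodup_cons.mp hM
    rw [List.filter_cons_of_neg (by simpa using fun h' => ha (h.subset h')), ih hM]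
  | cons_cons a h ih =>
    obtain ⟨ha, hM⟩ := List.nodup_cons.mp hM
    rw [List.filter_cons_of_pos (by simp), List.cons_inj_right]
    refine Eq.trans (List.filter_congr fun i hi => ?_) (ih hM)
    have : i ≠ a := fun e => ha (e ▸ hi)
    simp [this]

theorem map_fst_serialRun_sublist (G : ASHG N R) (L : List N) (A : Finset N) :
    ((G.serialRun L A).map Prod.fst).Sublist L := by
  induction L generalizing A with
  | nil => simp [serialRun]
  | cons d L ih =>
    unfold serialRun
    split_ifs
    · simpa using ih _
    · exact (ih _).cons _

/-- Every dictator is the least member of her coalition if the players are asked in increasing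
order. -/
theorem le_of_mem_serialRun [Preorder N] (G : ASHG N R) {L : List N} (hL : L.Pairwise (· < ·))
    {A : Finset N} (hA : A ⊆ L.toFinset) {p : N × Finset N} (hp : p ∈ G.serialRun L A) :
    p.1 ∈ p.2 ∧ ∀ j ∈ p.2, p.1 ≤ j := by
  induction L generalizing A with
  | nil => simp [serialRun] at hp
  | cons d L ih =>
    have hL' := List.pairwise_cons.mp hL
    unfold serialRun at hp
    split_ifs at hp with hd
    · have hdC : d ∈ G.dictatorCoalition A d := Finset.mem_insert_self _ _
      rcases List.mem_cons.mp hp with rfl | hp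
      · refine ⟨hdC, fun j hj => ?_⟩
        have hjA := hA (Finset.insert_subset hd (Finset.filter_subset _ _) hj)
        rcases List.mem_cons.mp (List.mem_toFinset.mp hjA) with rfl | hj
        · exact le_rfl
        · exact (hL'.1 j hj).le
      · exact ih hL'.2 (subset_tail_of_sdiff hA hdC) hp
    · exact ih hL'.2 (subset_tail_of_notMem hA hd) hp

/-- All later coalitions lie in the complement of the current one, which gives disjointness; the
rest is what `Finpartition.ofExistsUnique` asks for. -/
theorem SerialDictatorship.existsUnique {G : ASHG N R} {A : Finset N} {L : List (Finset N)}
    (hL : G.SerialDictatorship A L) :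
    (∀ S ∈ L, S ⊆ A) ∧ (∅ ∉ L) ∧ ∀ i ∈ A, ∃! S, S ∈ L ∧ i ∈ S := by
  induction hL with
  | done => simp
  | step A d L hd _ ih =>
    have hCA : G.dictatorCoalition A d ⊆ A :=
      Finset.insert_subset hd (Finset.filter_subset _ _)
    obtain ⟨h1, h2, h3⟩ := ih
    refine ⟨?_, ?_, ?_⟩
    · simp only [List.mem_cons, forall_eq_or_imp]
      exact ⟨hCA, fun S hS => (h1 S hS).trans Finset.sdiff_subset⟩
    · simp only [List.mem_cons, not_or]
      exact ⟨(Finset.insert_ne_empty _ _).symm, h2⟩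
    · intro i hi
      by_cases hiC : i ∈ G.dictatorCoalition A d
      · refine ⟨_, ⟨List.mem_cons_self, hiC⟩, ?_⟩
        rintro S ⟨hS, hiS⟩
        rcases List.mem_cons.mp hS with rfl | hS
        · rfl
        · exact absurd hiC (Finset.mem_sdiff.mp (h1 S hS hiS)).2
      · obtain ⟨S, ⟨hS, hiS⟩, hu⟩ := h3 i (Finset.mem_sdiff.mpr ⟨hi, hiC⟩)
        refine ⟨S, ⟨List.mem_cons_of_mem _ hS, hiS⟩, ?_⟩
        rintro T ⟨hT, hiT⟩
        rcases List.mem_cons.mp hT with rfl | hT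
        · exact absurd hiT hiC
        · exact hu T ⟨hT, hiT⟩

/-- The outcome of serial dictatorship in which the dictator is always the least remaining
player. -/
def serialPartition {n : ℕ} (G : ASHG (Fin n) R) : Finpartition (Finset.univ : Finset (Fin n)) :=
  have h := (G.serialDictatorship_serialRun (List.finRange n) Finset.univ (by simp)).existsUnique
  Finpartition.ofExistsUnique ((G.serialRun (List.finRange n) Finset.univ).map Prod.snd).toFinset
    (fun S hS => h.1 S (List.mem_toFinset.mp hS))
    (fun i hi => by simpa only [List.mem_toFinset] using h.2.2 i hi)
    (fun h' => h.2.1 (List.mem_toFinset.mp h'))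

theorem isSerialDictatorshipOutcome_serialPartition {n : ℕ} (G : ASHG (Fin n) R) :
    G.IsSerialDictatorshipOutcome G.serialPartition :=
  ⟨_, G.serialDictatorship_serialRun (List.finRange n) Finset.univ (by simp), rfl⟩

theorem encodePartition_serialPartition {n : ℕ} (G : ASHG (Fin n) R) :
    encodePartition ⟨n, G.serialPartition⟩ =
      (G.serialRun (List.finRange n) Finset.univ).flatMap fun p =>
        (List.finRange n).map (fun j => GameSymbol.bit (decide (j ∈ p.2))) ++
          [GameSymbol.semicolon] := by
  have hsort : (List.finRange n).Pairwise (· < ·) := List.pairwise_lt_finRange n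
  have least := fun p => le_of_mem_serialRun G hsort (A := Finset.univ) (by simp) (p := p)
  have hpart : ∀ p ∈ G.serialRun (List.finRange n) Finset.univ, ∀ i ∈ p.2,
      G.serialPartition.part i = p.2 := fun p hp i hi =>
    G.serialPartition.part_eq_of_mem (List.mem_toFinset.mpr (List.mem_map_of_mem hp)) hi
  have hfilter : ((List.finRange n).filter fun i => ∀ j ∈ G.serialPartition.part i, i ≤ j) =
      (G.serialRun (List.finRange n) Finset.univ).map Prod.fst := by
    rw [← filter_mem_eq_of_sublist (G.map_fst_serialRun_sublist (List.finRange n) Finset.univ)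
      (List.nodup_finRange n)]
    refine List.filter_congr fun i _ => ?_
    rw [decide_eq_decide]
    constructor
    · intro h
      obtain ⟨p, hp, hp2⟩ := List.mem_map.mp (List.mem_toFinset.mp
        (G.serialPartition.part_mem.mpr (Finset.mem_univ i)))
      have hip : i ∈ p.2 := hp2 ▸ G.serialPartition.mem_part (Finset.mem_univ i)
      rw [← hp2] at h
      -- Both `i` and the dictator are least members of the same coalition.
      exact List.mem_map.mpr ⟨p, hp, ((least p hp).2 i hip).antisymm (h _ (least p hp).1)⟩
    · intro h
      obtain ⟨p, hp, rfl⟩ := List.mem_map.mp h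
      rw [hpart p hp _ (least p hp).1]
      exact (least p hp).2
  unfold encodePartition
  rw [hfilter, List.flatMap_map]
  refine List.flatMap_congr fun p hp => ?_
  simp only [hpart p hp _ (least p hp).1]

end Greedy

end ASHG

/-! ### A stack machine for serial dictatorship -/

namespace SerialMachine

open Turing

/-- What the machine records about a player before reading a row: her row has been read already,
or she belongs to an earlier coalition, or neither. -/
inductive Status
  | past
  | taken
  | free
  deriving DecidableEq

instance : Fintype Status where
  elems := {.past, .taken, .free}
  complete x := by cases x <;> decide

/-- Position of the machine in a row: before the diagonal entry, or behind it in a row whose player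
is a dictator, or behind it in a row whose player belongs to an earlier coalition. -/
inductive Mode
  | before
  | active
  | skip
  deriving DecidableEq

instance : Fintype Mode where
  elems := {.before, .active, .skip}
  complete x := by cases x <;> decide

/-- The effect of a matrix entry: given whether it is not negative and the status of the column,
the new status of the column, the membership bit to be written, and the new mode. -/
def entry : Mode → Status → Bool → Status × Bool × Mode
  | .before, .past, _ => (.past, false, .before)
  | .before, .taken, _ => (.past, false, .skip)
  | .before, .free, _ => (.past, true, .active)
  | .active, .free, true => (.taken, true, .active)
  | .active, s, _ => (s, false, .active)
  | .skip, s, _ => (s, false, .skip)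

/-- The stacks of the machine. -/
inductive Stack
  | input
  | todo
  | done
  | log
  | output
  deriving DecidableEq

instance : Fintype Stack where
  elems := {.input, .todo, .done, .log, .output}
  complete x := by cases x <;> decide

/-- The alphabets of the stacks. -/
def Alphabet : Stack → Type
  | .input => GameSymbol
  | .todo => Status
  | .done => Status
  | .log => GameSymbol
  | .output => GameSymbol

/-- The labels of the machine. -/
inductive Label
  | scan
  | advance
  | restore
  | clear
  | write
  deriving DecidableEq

instance : Fintype Label where
  elems := {.scan, .advance, .restore, .clear, .write}
  complete x := by cases x <;> decide

/-- The internal states of the machine: the mode, the last symbol read, and the status of the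
current column. -/
abbrev State := Mode × Option GameSymbol × Status

/-- The state between two steps in mode `m`. -/
def rest (m : Mode) : State := (m, none, .free)

/-- The separator that ends a row in the log: a comma marks the rows to be dropped. -/
def rowEnd : Mode → GameSymbol
  | .skip => .comma
  | _ => .semicolon

/-- The effect of the current entry, determined by its first symbol. -/
def State.entry (v : State) : Status × Bool × Mode :=
  SerialMachine.entry v.1 v.2.2 (decide (v.2.1 ≠ some .minus))

/-- The program. Each row is logged as a row of bits; a row whose player is not a dictator gets a
terminator that makes the final copying phase drop it. -/
def program : Label → TM2.Stmt Alphabet Label State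
  | .scan =>
    .pop .input (fun v x => (v.1, x, v.2.2)) <|
    .branch (fun v => v.2.1 = none)
      (.load (fun _ => rest .before) <| .goto fun _ => .clear) <|
    .branch (fun v => v.2.1 = some .semicolon)
      (.push .log (fun v => rowEnd v.1) <| .load (fun _ => rest .before) <|
        .goto fun _ => .restore) <|
    -- In the first row this stack is still empty; the default `.free` is then the correct status of
    -- every column.
    .pop .todo (fun v s => (v.1, v.2.1, s.getD .free)) <|
    .push .done (fun v => v.entry.1) <|
    .push .log (fun v => .bit v.entry.2.1) <|
    .load (fun v => rest v.entry.2.2) <|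
    .goto fun _ => .advance
  | .advance =>
    .pop .input (fun v x => (v.1, x, v.2.2)) <|
    .branch (fun v => v.2.1 = some .comma)
      (.load (fun v => rest v.1) <| .goto fun _ => .scan)
      (.load (fun v => rest v.1) <| .goto fun _ => .advance)
  | .restore =>
    .peek .done (fun v s => (v.1, s.map fun _ => .comma, v.2.2)) <|
    .branch (fun v => v.2.1 = none)
      (.load (fun v => rest v.1) <| .goto fun _ => .scan) <|
    .pop .done (fun v s => (v.1, v.2.1, s.getD .free)) <|
    .push .todo (fun v => v.2.2) <|
    .load (fun v => rest v.1) <|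
    .goto fun _ => .restore
  | .clear =>
    .pop .todo (fun v s => (v.1, s.map fun _ => .comma, v.2.2)) <|
    .branch (fun v => v.2.1 = none)
      (.load (fun v => rest v.1) <| .goto fun _ => .write) <|
    .load (fun v => rest v.1) <|
    .goto fun _ => .clear
  | .write =>
    .pop .log (fun v x => (v.1, x, v.2.2)) <|
    .branch (fun v => v.2.1 = none)
      (.load (fun _ => rest .before) .halt) <|
    .branch (fun v => v.2.1 = some .comma)
      (.load (fun _ => rest .skip) <| .goto fun _ => .write) <|
    .branch (fun v => v.2.1 = some .semicolon)
      (.push .output (fun _ => .semicolon) <| .load (fun _ => rest .active) <|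
        .goto fun _ => .write) <|
    .branch (fun v => v.1 = .skip)
      (.load (fun v => rest v.1) <| .goto fun _ => .write) <|
    .push .output (fun v => v.2.1.getD .semicolon) <|
    .load (fun v => rest v.1) <|
    .goto fun _ => .write

/-- The machine that performs serial dictatorship. -/
def machine : FinTM2 where
  K := Stack
  k₀ := .input
  k₁ := .output
  Γ := Alphabet
  Λ := Label
  main := .scan
  σ := State
  initialState := rest .before
  Γk₀Fin := inferInstanceAs (Fintype GameSymbol)
  m := program

/-- The configuration with the given label, mode and stacks. -/
def cfg (l : Option Label) (m : Mode) (inp : List GameSymbol) (todo done : List Status)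
    (log out : List GameSymbol) : machine.Cfg where
  l := l
  var := rest m
  stk
    | .input => inp
    | .todo => todo
    | .done => done
    | .log => log
    | .output => out

/-- The machine passes from `c` to `c'` in at most `t` steps. -/
def Reach (t : ℕ) (c c' : machine.Cfg) : Prop :=
  ∃ k ≤ t, (flip bind machine.step)^[k] (some c) = some c'

theorem Reach.refl (c : machine.Cfg) : Reach 0 c c := ⟨0, le_rfl, rfl⟩

theorem Reach.trans {s t : ℕ} {a b c : machine.Cfg} (h₁ : Reach s a b) (h₂ : Reach t b c) :
    Reach (s + t) a c := by
  obtain ⟨k, hk, e⟩ := h₁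
  obtain ⟨l, hl, e'⟩ := h₂
  exact ⟨l + k, by omega, by rw [Function.iterate_add_apply, e, e']⟩

theorem Reach.mono {s t : ℕ} {a b : machine.Cfg} (h : Reach s a b) (hst : s ≤ t) : Reach t a b :=
  let ⟨k, hk, e⟩ := h
  ⟨k, hk.trans hst, e⟩

theorem Reach.of_step {a b : machine.Cfg} (h : machine.step a = some b) : Reach 1 a b :=
  ⟨1, le_rfl, h⟩

theorem Reach.head {t : ℕ} {a b c : machine.Cfg} (h : machine.step a = some b)
    (h' : Reach t b c) : Reach (t + 1) a c :=
  ((Reach.of_step h).trans h').mono (by omega)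

/-! ### Single steps of the machine -/

section Steps

variable (m : Mode) (inp : List GameSymbol) (todo done : List Status) (log out : List GameSymbol)

/-- A step builds the stacks by nested updates; compared stack by stack, they agree by definition.
-/
theorem cfg_ext {l : Option Label} {v : State} {S T : ∀ k, List (Alphabet k)} (h : ∀ k, S k = T k) :
    (some ⟨l, v, S⟩ : Option (TM2.Cfg Alphabet Label State)) = some ⟨l, v, T⟩ := by
  rw [funext h]

theorem step_scan_nil : machine.step (cfg (some .scan) m [] todo done log out) =
    some (cfg (some .clear) .before [] todo done log out) := by
  refine cfg_ext ?_
  rintro (_ | _) <;> rfl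

theorem step_scan_semicolon :
    machine.step (cfg (some .scan) m (.semicolon :: inp) todo done log out) =
      some (cfg (some .restore) .before inp todo done (rowEnd m :: log) out) := by
  refine cfg_ext ?_
  rintro (_ | _) <;> rfl

theorem step_scan_entry (x : GameSymbol) (hx : x ≠ .semicolon) :
    machine.step (cfg (some .scan) m (x :: inp) todo done log out) =
      let r := entry m (todo.head?.getD .free) (decide (x ≠ .minus))
      some (cfg (some .advance) r.2.2 inp todo.tail (r.1 :: done) (.bit r.2.1 :: log) out) := by
  rcases x with _ | _ | _ | _ | _
  all_goals first
    | exact absurd rfl hx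
    | (refine cfg_ext ?_
       rintro (_ | _) <;> rfl)

theorem step_advance (x : GameSymbol) (hx : x ≠ .comma) :
    machine.step (cfg (some .advance) m (x :: inp) todo done log out) =
      some (cfg (some .advance) m inp todo done log out) := by
  rcases x with _ | _ | _ | _ | _
  all_goals first
    | exact absurd rfl hx
    | (refine cfg_ext ?_
       rintro (_ | _) <;> rfl)

theorem step_advance_comma :
    machine.step (cfg (some .advance) m (.comma :: inp) todo done log out) =
      some (cfg (some .scan) m inp todo done log out) := by
  refine cfg_ext ?_
  rintro (_ | _) <;> rfl

theorem step_restore_nil : machine.step (cfg (some .restore) m inp todo [] log out) =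
    some (cfg (some .scan) m inp todo [] log out) := rfl

theorem step_restore_cons (s : Status) :
    machine.step (cfg (some .restore) m inp todo (s :: done) log out) =
      some (cfg (some .restore) m inp (s :: todo) done log out) := by
  refine cfg_ext ?_
  rintro (_ | _) <;> rfl

theorem step_clear_nil : machine.step (cfg (some .clear) m inp [] done log out) =
    some (cfg (some .write) m inp [] done log out) := by
  refine cfg_ext ?_
  rintro (_ | _) <;> rfl

theorem step_clear_cons (s : Status) :
    machine.step (cfg (some .clear) m inp (s :: todo) done log out) =
      some (cfg (some .clear) m inp todo done log out) := by
  refine cfg_ext ?_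
  rintro (_ | _) <;> rfl

theorem step_write_nil : machine.step (cfg (some .write) m inp todo done [] out) =
    some (cfg none .before inp todo done [] out) := by
  refine cfg_ext ?_
  rintro (_ | _) <;> rfl

theorem step_write_comma :
    machine.step (cfg (some .write) m inp todo done (.comma :: log) out) =
      some (cfg (some .write) .skip inp todo done log out) := by
  refine cfg_ext ?_
  rintro (_ | _) <;> rfl

theorem step_write_semicolon :
    machine.step (cfg (some .write) m inp todo done (.semicolon :: log) out) =
      some (cfg (some .write) .active inp todo done log (.semicolon :: out)) := by
  refine cfg_ext ?_
  rintro (_ | _) <;> rfl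

theorem step_write_skip (b : Bool) :
    machine.step (cfg (some .write) .skip inp todo done (.bit b :: log) out) =
      some (cfg (some .write) .skip inp todo done log out) := by
  refine cfg_ext ?_
  rintro (_ | _) <;> rfl

theorem step_write_active (b : Bool) :
    machine.step (cfg (some .write) .active inp todo done (.bit b :: log) out) =
      some (cfg (some .write) .active inp todo done log (.bit b :: out)) := by
  refine cfg_ext ?_
  rintro (_ | _) <;> rfl

end Steps

/-! ### Loops of the machine -/

section Phases

variable (m : Mode) (inp : List GameSymbol) (todo done : List Status) (log out : List GameSymbol)

theorem reach_advance (w : List GameSymbol) (hw : GameSymbol.comma ∉ w) :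
    Reach (w.length + 1) (cfg (some .advance) m (w ++ .comma :: inp) todo done log out)
      (cfg (some .scan) m inp todo done log out) := by
  induction w with
  | nil => exact .of_step (step_advance_comma ..)
  | cons x w ih =>
    simp only [List.mem_cons, not_or] at hw
    exact .head (step_advance _ _ _ _ _ _ x (Ne.symm hw.1)) (ih hw.2)

theorem reach_restore :
    Reach (done.length + 1) (cfg (some .restore) m inp todo done log out)
      (cfg (some .scan) m inp (done.reverse ++ todo) [] log out) := by
  induction done generalizing todo with
  | nil => exact .of_step (step_restore_nil ..)
  | cons s done ih =>
    refine .head (step_restore_cons ..) ?_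
    simpa using ih (s :: todo)

theorem reach_clear :
    Reach (todo.length + 1) (cfg (some .clear) m inp todo done log out)
      (cfg (some .write) m inp [] done log out) := by
  induction todo with
  | nil => exact .of_step (step_clear_nil ..)
  | cons s todo ih => exact .head (step_clear_cons ..) ih

theorem reach_write_skip (bits : List Bool) :
    Reach bits.length
      (cfg (some .write) .skip inp todo done (bits.map GameSymbol.bit ++ log) out)
      (cfg (some .write) .skip inp todo done log out) := by
  induction bits with
  | nil => exact .refl _
  | cons b bits ih => exact .head (step_write_skip ..) ih

theorem reach_write_active (bits : List Bool) :
    Reach bits.length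
      (cfg (some .write) .active inp todo done (bits.map GameSymbol.bit ++ log) out)
      (cfg (some .write) .active inp todo done log
        ((bits.map GameSymbol.bit).reverse ++ out)) := by
  induction bits generalizing out with
  | nil => exact .refl _
  | cons b bits ih =>
    refine .head (step_write_active ..) ?_
    simpa using ih (.bit b :: out)

/-- The slash makes every code nonempty, and a minus sign can only come from the optional prefix. So
the sign is known after one symbol, and the rest can be skipped up to the comma. -/
theorem encodeRat_eq_cons (q : ℚ) : ∃ x w, encodeRat q = x :: w ∧ x ≠ .semicolon ∧
    .comma ∉ w ∧ (x ≠ .minus ↔ 0 ≤ q) := by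
  have hc : GameSymbol.comma ∉ encodeRat q := notMem_encodeRat (by simp) (by simp) (by simp)
  have hs : GameSymbol.semicolon ∉ encodeRat q := notMem_encodeRat (by simp) (by simp) (by simp)
  have hm := fun k => notMem_encodeBinary (k := k) (s := .minus) (by simp)
  rcases h : encodeRat q with _ | ⟨x, w⟩
  · simp [encodeRat] at h
  rw [h] at hc hs
  simp only [List.mem_cons, not_or] at hc hs
  refine ⟨x, w, rfl, Ne.symm hs.1, hc.2, ?_⟩
  unfold encodeRat at h
  split_ifs at h with hq
  · simp only [List.cons_append, List.cons.injEq] at h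
    simp [← h.1, hq]
  · simp only [List.nil_append] at h
    refine iff_of_true ?_ (not_lt.mp hq)
    rintro rfl
    have : GameSymbol.minus ∈ encodeBinary q.num.natAbs ++ .slash :: encodeBinary q.den := by
      simp [h]
    simp [hm] at this

theorem reach_entry (q : ℚ) :
    let r := entry m (todo.head?.getD .free) (decide (0 ≤ q))
    Reach ((encodeRat q).length + 1)
      (cfg (some .scan) m (encodeRat q ++ .comma :: inp) todo done log out)
      (cfg (some .scan) r.2.2 inp todo.tail (r.1 :: done) (.bit r.2.1 :: log) out) := by
  obtain ⟨x, w, h, hs, hc, hm⟩ := encodeRat_eq_cons q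
  rw [h, ← decide_eq_decide.mpr hm]
  exact .head (step_scan_entry _ _ _ _ _ _ x hs) (reach_advance _ _ _ _ _ _ w hc)

/-- The effect of a sequence of matrix entries: the new statuses of the columns, the membership
bits, and the final mode. -/
def scanRow : Mode → List (Status × Bool) → List (Status × Bool) × Mode
  | m, [] => ([], m)
  | m, (s, b) :: l =>
    let r := entry m s b
    let t := scanRow r.2.2 l
    ((r.1, r.2.1) :: t.1, t.2)

/-- The second alternative for `todo` covers the first row, where popping the empty stack yields
`.free`. -/
theorem reach_scanRow {α : Type*} (J : List α) (st : α → Status) (val : α → ℚ)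
    (htodo : todo = J.map st ∨ todo = [] ∧ ∀ j ∈ J, st j = .free) :
    let r := scanRow m (J.map fun j => (st j, decide (0 ≤ val j)))
    Reach (J.flatMap fun j => encodeRat (val j) ++ [GameSymbol.comma]).length
      (cfg (some .scan) m
        ((J.flatMap fun j => encodeRat (val j) ++ [GameSymbol.comma]) ++ inp) todo done log out)
      (cfg (some .scan) r.2 inp [] ((r.1.map Prod.fst).reverse ++ done)
        ((r.1.map fun p => GameSymbol.bit p.2).reverse ++ log) out) := by
  induction J generalizing m todo done log with
  | nil =>
    obtain rfl : todo = [] := by simpa using htodo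
    exact .refl _
  | cons j J ih =>
    have hhead : todo.head?.getD .free = st j := by
      rcases htodo with rfl | ⟨rfl, h⟩
      · rfl
      · exact (h j (by simp)).symm
    have htail : todo.tail = J.map st ∨ todo.tail = [] ∧ ∀ j ∈ J, st j = .free := by
      rcases htodo with rfl | ⟨rfl, h⟩
      · exact .inl rfl
      · exact .inr ⟨rfl, fun k hk => h k (List.mem_cons_of_mem _ hk)⟩
    have h1 := reach_entry m
      ((J.flatMap fun j => encodeRat (val j) ++ [GameSymbol.comma]) ++ inp) todo done log out
      (val j)
    rw [hhead] at h1
    have h2 := h1.trans (ih _ _ _ _ htail)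
    simpa [scanRow, add_assoc, add_comm, add_left_comm] using h2

end Phases

/-! ### Correctness and running time row by row -/

section Rows

variable {n : ℕ} {G : ASHG (Fin n) ℚ}

/-- The status of player `j` before row `i` is read if the players in `A` remain. -/
def status (A : Finset (Fin n)) (i : ℕ) (j : Fin n) : Status :=
  if j < i then .past else if j ∈ A then .free else .taken

/-- The coalition formed when the row of player `i` is read while the players in `A` remain. -/
def rowCoalition (G : ASHG (Fin n) ℚ) (A : Finset (Fin n)) (i : Fin n) : Finset (Fin n) :=
  if i ∈ A then G.dictatorCoalition A i else ∅

theorem scanRow_map_of_entry {α : Type*} {m : Mode} {J : List α} {s s' : α → Status}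
    {p b : α → Bool} (h : ∀ j ∈ J, entry m (s j) (p j) = (s' j, b j, m)) :
    scanRow m (J.map fun j => (s j, p j)) = (J.map fun j => (s' j, b j), m) := by
  induction J with
  | nil => rfl
  | cons j J ih =>
    have ih := ih fun k hk => h k (List.mem_cons_of_mem _ hk)
    have hj := h j (by simp)
    simp only [List.map_cons, scanRow, hj, ih]

theorem entry_active (hG : G.IsStrict) {A : Finset (Fin n)} {i j : Fin n} (hi : i ∈ A)
    (hij : i < j) :
    entry .active (status A i j) (decide (0 ≤ G.value i j)) =
      (status (A \ rowCoalition G A i) (i + 1) j, decide (j ∈ rowCoalition G A i), .active) := by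
  -- The machine tests only for a minus sign; strictness turns this into a test for positivity.
  have hv : 0 ≤ G.value i j ↔ 0 < G.value i j :=
    ⟨fun h => lt_of_le_of_ne h (hG i j hij.ne).symm, le_of_lt⟩
  have hC : j ∈ G.dictatorCoalition A i ↔ j ∈ A ∧ 0 < G.value i j := by
    simp [ASHG.dictatorCoalition, hij.ne']
  by_cases hA : j ∈ A <;> by_cases hp : 0 < G.value i j <;>
    simp [status, entry, rowCoalition, hi, hij.not_gt, hij.not_ge, hv, hC, hA, hp]

theorem entry_skip {A : Finset (Fin n)} {i j : Fin n} (hi : i ∉ A) (hij : i < j) :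
    entry .skip (status A i j) (decide (0 ≤ G.value i j)) =
      (status (A \ rowCoalition G A i) (i + 1) j, decide (j ∈ rowCoalition G A i), .skip) := by
  simp [status, entry, rowCoalition, hi, hij.not_gt, hij.not_ge]

theorem entry_before {A : Finset (Fin n)} {i j : Fin n} (hA : ∀ j ∈ A, i ≤ j) (hij : j < i) :
    entry .before (status A i j) (decide (0 ≤ G.value i j)) =
      (status (A \ rowCoalition G A i) (i + 1) j, decide (j ∈ rowCoalition G A i), .before) := by
  have hjA : j ∉ A := fun h => (hA j h).not_gt hij
  have hC : j ∉ rowCoalition G A i := by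
    unfold rowCoalition
    split_ifs
    · simp [ASHG.dictatorCoalition, hij.ne, hjA]
    · simp
  simp [status, entry, hij, hij.le, hC]

theorem entry_diagonal (A : Finset (Fin n)) (i : Fin n) :
    entry .before (status A i i) (decide (0 ≤ G.value i i)) =
      (status (A \ rowCoalition G A i) (i + 1) i, decide (i ∈ rowCoalition G A i),
        if i ∈ A then .active else .skip) := by
  by_cases hi : i ∈ A <;>
    simp [status, entry, rowCoalition, hi, ASHG.dictatorCoalition]

/-- The mode changes only at the diagonal; behind it the mode is constant and `scanRow_map_of_entry`
handles the rest of the row. -/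
theorem scanRow_before (hG : G.IsStrict) {A : Finset (Fin n)} {i : Fin n} (hA : ∀ j ∈ A, i ≤ j)
    {J : List (Fin n)} (hJ : J.Pairwise (· < ·)) (hi : i ∈ J) :
    scanRow .before (J.map fun j => (status A i j, decide (0 ≤ G.value i j))) =
      (J.map fun j => (status (A \ rowCoalition G A i) (i + 1) j,
        decide (j ∈ rowCoalition G A i)), if i ∈ A then .active else .skip) := by
  induction J with
  | nil => simp at hi
  | cons j J ih =>
    obtain ⟨hj, hJ⟩ := List.pairwise_cons.mp hJ
    rcases List.mem_cons.mp hi with rfl | hi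
    · simp only [List.map_cons, scanRow, entry_diagonal]
      split_ifs with hiA
      · rw [scanRow_map_of_entry fun k hk => entry_active hG hiA (hj k hk)]
      · rw [scanRow_map_of_entry fun k hk => entry_skip hiA (hj k hk)]
    · simp only [List.map_cons, scanRow, entry_before hA (hj i hi), ih hJ hi]

/-- A row of the log. -/
def logRow (G : ASHG (Fin n) ℚ) (A : Finset (Fin n)) (i : Fin n) : List GameSymbol :=
  ((List.finRange n).map fun j => GameSymbol.bit (decide (j ∈ rowCoalition G A i))) ++
    [if i ∈ A then .semicolon else .comma]

/-- The log of the rows of the players in a list, in order. -/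
def logRows (G : ASHG (Fin n) ℚ) : List (Fin n) → Finset (Fin n) → List GameSymbol
  | [], _ => []
  | i :: L, A => logRow G A i ++ logRows G L (A \ rowCoalition G A i)

theorem mul_length_le_length_flatMap {α β : Type*} {c : ℕ} {f : α → List β} {L : List α}
    (h : ∀ a ∈ L, c ≤ (f a).length) : L.length * c ≤ (L.flatMap f).length := by
  induction L with
  | nil => simp
  | cons a L ih =>
    have h1 := h a (by simp)
    have h2 := ih fun b hb => h b (List.mem_cons_of_mem _ hb)
    simp only [List.length_cons, List.flatMap_cons, List.length_append]
    linarith [Nat.succ_mul L.length c]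

/-- The code of a row of the value matrix. -/
def encodeRow (G : ASHG (Fin n) ℚ) (i : Fin n) : List GameSymbol :=
  ((List.finRange n).flatMap fun j => encodeRat (G.value i j) ++ [GameSymbol.comma]) ++
    [GameSymbol.semicolon]

theorem lt_length_encodeRow (G : ASHG (Fin n) ℚ) (i : Fin n) : n < (encodeRow G i).length := by
  have := mul_length_le_length_flatMap (c := 1) (L := List.finRange n)
    (f := fun j => encodeRat (G.value i j) ++ [GameSymbol.comma]) (by simp)
  rw [List.length_finRange, mul_one] at this
  rw [encodeRow, List.length_append, List.length_singleton]
  omega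

theorem reach_encodeRow (hG : G.IsStrict) {A : Finset (Fin n)} {i : Fin n} (hA : ∀ j ∈ A, i ≤ j)
    (inp : List GameSymbol) (todo : List Status) (log out : List GameSymbol)
    (htodo : todo = (List.finRange n).map (status A i) ∨
      todo = [] ∧ ∀ j ∈ List.finRange n, status A i j = .free) :
    Reach (2 * (encodeRow G i).length)
      (cfg (some .scan) .before (encodeRow G i ++ inp) todo [] log out)
      (cfg (some .scan) .before inp
        ((List.finRange n).map (status (A \ rowCoalition G A i) (i + 1))) []
        ((logRow G A i).reverse ++ log) out) := by
  have h1 := reach_scanRow .before (.semicolon :: inp) todo [] log out (List.finRange n)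
    (status A i) (G.value i) htodo
  rw [scanRow_before hG hA (List.pairwise_lt_finRange n) (List.mem_finRange i)] at h1
  have h2 := h1.trans ((Reach.of_step (step_scan_semicolon ..)).trans (reach_restore ..))
  have hlen := lt_length_encodeRow G i
  have hlog : (if i ∈ A then GameSymbol.semicolon else .comma) =
      rowEnd (if i ∈ A then .active else .skip) := by split_ifs <;> rfl
  rw [logRow, hlog]
  -- Reading the row takes at most its length, and restoring the `n` statuses takes at most `n + 1`
  -- further steps, which is again at most the length of the row.
  have key := h2.mono (t := 2 * (encodeRow G i).length) (by
    unfold encodeRow at hlen ⊢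
    simp only [List.length_append, List.length_singleton, List.length_reverse, List.length_map,
      List.length_finRange, List.length_nil] at hlen ⊢
    omega)
  simpa [encodeRow, Function.comp_def] using key

/-- Induction on the number `k` of unread rows. The invariant that all remaining players are at
least `i` makes player `i` the least remaining one if she remains at all; the bound on `todo'` pays
for clearing that stack later. -/
theorem reach_rows (hG : G.IsStrict) (out : List GameSymbol) (k : ℕ) :
    ∀ (i : ℕ) (A : Finset (Fin n)) (todo : List Status) (log : List GameSymbol), i + k = n →
      (∀ j ∈ A, i ≤ j.val) → todo.length ≤ n →
      (todo = (List.finRange n).map (status A i) ∨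
        todo = [] ∧ ∀ j ∈ List.finRange n, status A i j = .free) →
      ∃ todo' : List Status, todo'.length ≤ n ∧
        Reach (2 * (((List.finRange n).drop i).flatMap (encodeRow G)).length)
          (cfg (some .scan) .before (((List.finRange n).drop i).flatMap (encodeRow G)) todo []
            log out)
          (cfg (some .scan) .before [] todo' []
            ((logRows G ((List.finRange n).drop i) A).reverse ++ log) out) := by
  induction k with
  | zero =>
    intro i A todo log hi _ hlen _
    refine ⟨todo, hlen, ?_⟩
    rw [List.drop_eq_nil_of_le (by simp; omega)]
    exact .refl _
  | succ k ih =>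
    intro i A todo log hi hA _ htodo
    have hin : i < n := by omega
    have hdrop : (List.finRange n).drop i = ⟨i, hin⟩ :: (List.finRange n).drop (i + 1) := by
      rw [List.drop_eq_getElem_cons (by simpa using hin)]
      simp
    have hA' : ∀ j ∈ A \ rowCoalition G A ⟨i, hin⟩, i + 1 ≤ j.val := by
      intro j hj
      obtain ⟨hjA, hjC⟩ := Finset.mem_sdiff.mp hj
      -- If player `i` remains, she is the dictator and leaves with her own coalition.
      refine lt_of_le_of_ne (hA j hjA) fun e => hjC ?_
      obtain rfl : (⟨i, hin⟩ : Fin n) = j := Fin.ext e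
      simp [rowCoalition, hjA, ASHG.dictatorCoalition]
    have h1 := reach_encodeRow hG (A := A) (i := ⟨i, hin⟩) (fun j hj => Fin.le_def.mpr (hA j hj))
      (((List.finRange n).drop (i + 1)).flatMap (encodeRow G)) todo log out htodo
    obtain ⟨todo', hlen, h2⟩ := ih (i + 1) (A \ rowCoalition G A ⟨i, hin⟩) _
      ((logRow G A ⟨i, hin⟩).reverse ++ log) (by omega) hA' (by simp) (.inl rfl)
    refine ⟨todo', hlen, ?_⟩
    rw [hdrop]
    simp only [List.flatMap_cons, List.length_append, mul_add, logRows, List.reverse_append,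
      List.append_assoc]
    exact h1.trans h2

/-- The code of the coalitions formed by a run of serial dictatorship. -/
def encodeRun (p : List (Fin n × Finset (Fin n))) : List GameSymbol :=
  p.flatMap fun p =>
    (List.finRange n).map (fun j => GameSymbol.bit (decide (j ∈ p.2))) ++ [GameSymbol.semicolon]

theorem reach_write_logRow (G : ASHG (Fin n) ℚ) (A : Finset (Fin n)) (i : Fin n) (m : Mode)
    (inp : List GameSymbol) (todo done : List Status) (log out : List GameSymbol) :
    ∃ m', Reach (n + 1) (cfg (some .write) m inp todo done ((logRow G A i).reverse ++ log) out)
      (cfg (some .write) m' inp todo done log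
        (encodeRun (if i ∈ A then [(i, G.dictatorCoalition A i)] else []) ++ out)) := by
  have hrev : (logRow G A i).reverse ++ log = (if i ∈ A then .semicolon else .comma) ::
      ((((List.finRange n).map fun j => decide (j ∈ rowCoalition G A i)).reverse.map
        GameSymbol.bit) ++ log) := by
    simp [logRow, Function.comp_def]
  rw [hrev]
  split_ifs with hi
  · refine ⟨.active, .head (step_write_semicolon ..) ?_⟩
    have h := reach_write_active inp todo done log (.semicolon :: out)
      ((List.finRange n).map fun j => decide (j ∈ rowCoalition G A i)).reverse
    simpa [encodeRun, rowCoalition, hi, Function.comp_def] using h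
  · refine ⟨.skip, .head (step_write_comma ..) ?_⟩
    have h := reach_write_skip inp todo done log out
      ((List.finRange n).map fun j => decide (j ∈ rowCoalition G A i)).reverse
    simpa [encodeRun] using h

/-- The last row is on top of the log, so the tail of the list is written first and the row of its
head is put in front of it. -/
theorem reach_write_logRows (G : ASHG (Fin n) ℚ) (L : List (Fin n)) (A : Finset (Fin n)) (m : Mode)
    (inp : List GameSymbol) (todo done : List Status) (log out : List GameSymbol) :
    ∃ m', Reach (L.length * (n + 1))
      (cfg (some .write) m inp todo done ((logRows G L A).reverse ++ log) out)
      (cfg (some .write) m' inp todo done log (encodeRun (G.serialRun L A) ++ out)) := by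
  induction L generalizing A m log out with
  | nil => exact ⟨m, by simpa [logRows, encodeRun, ASHG.serialRun] using Reach.refl _⟩
  | cons i L ih =>
    have hrun : G.serialRun (i :: L) A = (if i ∈ A then [(i, G.dictatorCoalition A i)] else []) ++
        G.serialRun L (A \ rowCoalition G A i) := by
      by_cases hi : i ∈ A <;> simp [ASHG.serialRun, rowCoalition, hi]
    obtain ⟨m₁, h₁⟩ := ih (A \ rowCoalition G A i) m ((logRow G A i).reverse ++ log) out
    obtain ⟨m₂, h₂⟩ := reach_write_logRow G A i m₁ inp todo done log
      (encodeRun (G.serialRun L (A \ rowCoalition G A i)) ++ out)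
    refine ⟨m₂, ?_⟩
    have h := h₁.trans h₂
    rw [hrun, logRows, encodeRun, List.flatMap_append, List.reverse_append, List.append_assoc,
      List.append_assoc, List.length_cons, Nat.succ_mul]
    exact h

theorem reach_output (hG : G.IsStrict) :
    Reach (4 * ((List.finRange n).flatMap (encodeRow G)).length + 3)
      (cfg (some .scan) .before ((List.finRange n).flatMap (encodeRow G)) [] [] [] [])
      (cfg none .before [] [] [] [] (encodeRun (G.serialRun (List.finRange n) Finset.univ))) := by
  obtain ⟨todo, hlen, h₁⟩ := reach_rows hG [] n 0 Finset.univ [] [] (by simp) (by simp) (by simp)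
    (.inr ⟨rfl, by simp [status]⟩)
  obtain ⟨m, h₂⟩ := reach_write_logRows G (List.finRange n) Finset.univ .before [] [] [] [] []
  rw [List.drop_zero] at h₁
  rw [List.append_nil] at h₁ h₂
  rw [List.append_nil] at h₂
  have h := ((h₁.trans (.of_step (step_scan_nil ..))).trans (reach_clear ..)).trans
    (h₂.trans (.of_step (step_write_nil ..)))
  -- With input length `W`, reading costs `2 * W`, clearing at most `n + 1`, writing `n * (n + 1)`,
  -- and two single steps remain. Both `n` and `n * (n + 1)` are at most `W`.
  refine h.mono ?_
  have := mul_length_le_length_flatMap (c := n + 1) (L := List.finRange n) (f := encodeRow G)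
    fun i _ => lt_length_encodeRow G i
  rw [List.length_finRange] at this ⊢
  nlinarith

end Rows

/-! ### Polynomial-time computability and the main theorem -/

theorem initList_machine (w : List GameSymbol) :
    initList machine w = cfg (some .scan) .before w [] [] [] [] := by
  unfold initList cfg
  congr 1
  funext k
  cases k <;> rfl

theorem haltList_machine (w : List GameSymbol) :
    haltList machine w = cfg none .before [] [] [] [] w := by
  unfold haltList cfg
  congr 1
  funext k
  cases k <;> rfl

theorem exists_steps_encodeGame (I : StrictGame) :
    ∃ k ≤ (4 * Polynomial.X + 3 : Polynomial ℕ).eval (encodeGame I).length,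
      (flip bind machine.step)^[k] (some (initList machine (encodeGame I))) =
        some (haltList machine (encodePartition ⟨I.n, I.game.serialPartition⟩)) := by
  rw [initList_machine, haltList_machine, ASHG.encodePartition_serialPartition]
  obtain ⟨k, hk, h⟩ := reach_output I.strict
  refine ⟨k, hk.trans (le_of_eq ?_), h⟩
  rw [Polynomial.eval_add, Polynomial.eval_mul, Polynomial.eval_X]
  simp only [Polynomial.eval_ofNat]
  rfl

/-- Serial dictatorship runs in polynomial time. -/
noncomputable def computableInPolyTime : TM2ComputableInPolyTime encodeGame encodePartition
    fun I : StrictGame => ⟨I.n, I.game.serialPartition⟩ where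
  tm := machine
  inputAlphabet := Equiv.refl GameSymbol
  outputAlphabet := Equiv.refl GameSymbol
  time := 4 * Polynomial.X + 3
  outputsFun I :=
    { steps := (exists_steps_encodeGame I).choose
      evals_in_steps := by
        erw [List.map_id, List.map_id]
        exact (exists_steps_encodeGame I).choose_spec.2
      steps_le_m := (exists_steps_encodeGame I).choose_spec.1 }

end SerialMachine

theorem mainTheorem2 :
    (∀ (N : Type*) [Fintype N] [DecidableEq N] (G : ASHG N ℝ), G.IsStrict →
      ∀ π : Finpartition (Finset.univ : Finset N),
        G.IsSerialDictatorshipOutcome π → G.IsParetoOptimal π) ∧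
    ∃ f : (I : StrictGame) → Finpartition (Finset.univ : Finset (Fin I.n)),
      Nonempty (Turing.TM2ComputableInPolyTime encodeGame encodePartition
        fun I : StrictGame => ⟨I.n, f I⟩) ∧
      ∀ I : StrictGame,
        I.game.IsSerialDictatorshipOutcome (f I) ∧ I.game.IsParetoOptimal (f I) := by
  exact ⟨fun _ _ _ _ hG _ hπ => hπ.isParetoOptimal hG,
    fun I => I.game.serialPartition, ⟨SerialMachine.computableInPolyTime⟩, fun I =>
      ⟨I.game.isSerialDictatorshipOutcome_serialPartition,
        I.game.isSerialDictatorshipOutcome_serialPartition.isParetoOptimal I.strict⟩⟩
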